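/- Let $K$ be an algebraically closed field of arbitrary characteristic, let $2\le s\le n$ and $m\ge 1$ be integers, and let $R=K[X_0,\dots,X_n]$ with its standard grading. Let $X=\{P_1,\dots,P_{s+3}\}$ be a set of $s+3$ distinct points of $\mathbb P^n_K$ which lie on a linear $s$-space $\gamma$ (a linear subspace of projective dimension $s$), and assume that $X$ does not lie on any linear $(s-1)$-space and that $X$ is not in general position on $\gamma$, i.e. for some $j<s$ some $j+2$ of the points lie on a linear $j$-space. Let $\wp_1,\dots,\wp_{s+3}\subset R$ be the homogeneous prime ideals of $P_1,\dots,P_{s+3}$. For $j=1,\dots,n$ put $$T_j=\max\left\{\left\lfloor\frac{mq+j-2}{j}\right\rfloor \;:\; q\ge 1 \text{ and some } q \text{ distinct points } P_{i_1},\dots,P_{i_q} \text{ of } X \text{ lie on a linear } j\text{-space}\right\}.$$ For a homogeneous ideal $I\subset R$ let $\operatorname{reg}(R/I)$ denote the regularity index of $R/I$, the least integer $t\ge 0$ such that the Hilbert function $u\mapsto\dim_K(R/I)_u$ agrees with the Hilbert polynomial of $R/I$ for all $u\ge t$; when $R/I\neq 0$ has finite length, this is the least $t\ge 0$ with $(R/I)_u=0$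 for all $u\ge t$. Then there is a point $P_{i_0}\in X$ such that $$\operatorname{reg}\bigl(R/(J+\wp_{i_0}^m)\bigr)\le\max\{T_j : j=1,\dots,n\},\qquad\text{where } J=\bigcap_{i\ne i_0}\wp_i^m .$$ -/

import Mathlib

namespace FatPoints

open scoped LinearAlgebra.Projectivization

variable {K : Type*} [Field K] {n : ℕ} {ι : Type*}

/-- The homogeneous prime ideal of a point `p` of `ℙⁿ` in `R = K[X₀, …, Xₙ]`: the ideal generated
by all forms vanishing at `p`. (Whether a form vanishes does not depend on the representative.) -/
noncomputable def pointIdeal (p : ℙ K (Fin (n + 1) → K)) : Ideal (MvPolynomial (Fin (n + 1)) K) :=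
  Ideal.span {f | (∃ d : ℕ, f.IsHomogeneous d) ∧ MvPolynomial.eval p.rep f = 0}

/-- The Hilbert function of `A = R / I` for a homogeneous ideal `I`: `t ↦ dim_K A_t`, where `A_t`
is the image in `R / I` of the space of forms of degree `t`. -/
noncomputable def hilbertFunction (I : Ideal (MvPolynomial (Fin (n + 1)) K)) (t : ℕ) : ℕ :=
  Module.finrank K
    ((MvPolynomial.homogeneousSubmodule (Fin (n + 1)) K t).map
      (Ideal.Quotient.mkₐ K I).toLinearMap)

/-- `r` is the regularity index of `R / I`: the least degree from which on the Hilbert function of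
`R / I` agrees with the Hilbert polynomial of `R / I`. (A polynomial which agrees with the Hilbert
function in all large degrees is the Hilbert polynomial. If `R / I` has finite length it is `0`,
and if `R / I` is the coordinate ring of a set of fat points it is the constant multiplicity.) -/
def IsRegularityIndex (I : Ideal (MvPolynomial (Fin (n + 1)) K)) (r : ℕ) : Prop :=
  IsLeast {t : ℕ | ∃ H : Polynomial ℚ, ∀ u : ℕ, t ≤ u →
    (hilbertFunction I u : ℚ) = H.eval (u : ℚ)} r

/-- The points `P i`, `i ∈ S`, lie on a linear `j`-space of `ℙⁿ`, that is, on the projectivization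
of a `(j + 1)`-dimensional linear subspace of `Kⁿ⁺¹`. -/
def LieOnLinearSpace (P : ι → ℙ K (Fin (n + 1) → K)) (S : Finset ι) (j : ℕ) : Prop :=
  ∃ L : Submodule K (Fin (n + 1) → K), Module.finrank K L = j + 1 ∧ ∀ i ∈ S, (P i).submodule ≤ L

/-- The points `P i` are in general position on the linear `r`-space `α`: they all lie on `α`, and
no `j + 2` of them lie on a linear `j`-space for `j < r`. -/
def InGeneralPositionOn (P : ι → ℙ K (Fin (n + 1) → K)) (r : ℕ)
    (α : Submodule K (Fin (n + 1) → K)) : Prop :=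
  Module.finrank K α = r + 1 ∧ (∀ i, (P i).submodule ≤ α) ∧
    ∀ j < r, ∀ S : Finset ι, S.card = j + 2 → ¬ LieOnLinearSpace P S j

open Classical in
/-- `T_j`, the maximum of `⌊(m q + j - 2) / j⌋` over all choices of `q ≥ 1` of the points that lie
on a linear `j`-space. For `m ≥ 1`, `j ≥ 1` we have `m q + j ≥ 2`, so nothing is truncated, and for
`j ≤ n` the maximum is over a nonempty family. -/
noncomputable def segreT [Fintype ι] (P : ι → ℙ K (Fin (n + 1) → K)) (m j : ℕ) : ℕ :=
  {S : Finset ι | S.Nonempty ∧ LieOnLinearSpace P S j}.toFinset.sup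
    fun S => (m * S.card + j - 2) / j

end FatPoints

/-! ### Linear forms and products in ideals of points -/

namespace FatPoints

open scoped LinearAlgebra.Projectivization

/-! The `s + 3` points span a vector space of dimension `s + 1`, so their relations form a plane. A
basis `w₁, w₂` of it attaches to each point `e` the vector `(w₁ e, w₂ e)` of `K²` (Gale duality).
Let `A` be the set of points with nonzero vector, split into classes by proportionality. Deleting
two points of different classes leaves independent representatives (`exists_dual`). On the other
hand the `q` points of `A` outside one class span dimension at most `q - 1`, and `A` itself at most
`|A| - 2`. Writing `max T_j = b = N + m`, the definition of `T_j` then gives `2m ≤ (q - 2)N + 1` and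
`3m ≤ (|A| - 3)N + 1`.

Fix `p = P_{i₀}`. It suffices that every product of `b` linear forms lies in `J + ℘_p^m`. The forms
vanishing at `p` are spanned by sparse ones, nonzero at no more than three of the points. Use
descending induction on the number `i` of sparse factors: `m` of them give an element of `℘_p^m`.
For `i < m` it is enough to complete them to an element of `J` by `N + m - i` forms not vanishing at
`p`, since any linear form is a multiple of a completing one plus a form vanishing at `p`.

Two points of different classes, other than `p`, yield a form that is `1` at `p` and vanishes at all
remaining points. Hence `N + m - i` such pairs are needed, each point `e` being used at most `N -
#{sparse factors nonzero at e}` times. `exists_pairing` finds them by a greedy argument once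
`weight_bounds` has checked its two inequalities. The failure of general position enters through the
choice of `p`: either `p ∉ A`, or some class has two points other than `p`. -/

/-- The linear form `∑ i, f (eᵢ) Xᵢ` attached to a functional `f`. -/
noncomputable def linForm (K : Type*) [Field K] (n : ℕ) :
    Module.Dual K (Fin (n + 1) → K) →ₗ[K] MvPolynomial (Fin (n + 1)) K where
  toFun f := ∑ i, f (Pi.single i 1) • MvPolynomial.X i
  map_add' f g := by simp [add_smul, Finset.sum_add_distrib]
  map_smul' a f := by simp [mul_smul, Finset.smul_sum]

theorem linForm_isHomogeneous {K : Type*} [Field K] {n : ℕ}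
    (f : Module.Dual K (Fin (n + 1) → K)) : (linForm K n f).IsHomogeneous 1 := by
  refine MvPolynomial.IsHomogeneous.sum _ _ _ fun i _ => ?_
  rw [MvPolynomial.smul_eq_C_mul]
  simpa using (MvPolynomial.isHomogeneous_C _ _).mul (MvPolynomial.isHomogeneous_X K i)

theorem eval_linForm {K : Type*} [Field K] {n : ℕ}
    (f : Module.Dual K (Fin (n + 1) → K)) (x : Fin (n + 1) → K) :
    MvPolynomial.eval x (linForm K n f) = f x := by
  conv_rhs => rw [pi_eq_sum_univ' x]
  simp only [linForm, LinearMap.coe_mk, AddHom.coe_mk, map_sum, MvPolynomial.smul_eval,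
    MvPolynomial.eval_X, map_smul, smul_eq_mul]
  exact Finset.sum_congr rfl fun i _ => mul_comm _ _

theorem linForm_mem_pointIdeal {K : Type*} [Field K] {n : ℕ}
    {f : Module.Dual K (Fin (n + 1) → K)} {p : ℙ K (Fin (n + 1) → K)} (h : f p.rep = 0) :
    linForm K n f ∈ pointIdeal p :=
  Ideal.subset_span ⟨⟨1, linForm_isHomogeneous f⟩, by rw [eval_linForm, h]⟩

theorem linForm_proj {K : Type*} [Field K] {n : ℕ} (i : Fin (n + 1)) :
    linForm K n (LinearMap.proj i) = MvPolynomial.X i := by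
  simp [linForm, Pi.single_apply]

theorem list_prod_mem_pow_countP {R α : Type*} [CommSemiring R] (I : Ideal R) (φ : α → R)
    (p : α → Prop) [DecidablePred p] (h : ∀ a, p a → φ a ∈ I) (l : List α) :
    (l.map φ).prod ∈ I ^ l.countP p := by
  induction l with
  | nil => simp
  | cons a l ih =>
    rw [List.map_cons, List.prod_cons, List.countP_cons]
    by_cases ha : p a
    · simpa [ha, pow_succ'] using Ideal.mul_mem_mul (h a ha) ih
    · simpa [ha] using Ideal.mul_mem_left _ _ ih

/-! ### Exchanging factors of a product -/

section Exchange

variable {K R D : Type*} [Field K] [CommRing R] [Algebra K R] [AddCommGroup D] [Module K D]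

/-- Replacing the factors of a product one by one. -/
theorem exists_prod_sub_smul_prod_mem (φ : D →ₗ[K] R) (I : Ideal R) (H : Submodule K D)
    (M : R) (t : ℕ)
    (hM : ∀ h ∈ H, ∀ gs : List D, gs.length + 1 = t → M * φ h * (gs.map φ).prod ∈ I) :
    ∀ gs Ls : List D, gs.length = Ls.length → (∀ L ∈ Ls, ∀ g, ∃ a : K, g - a • L ∈ H) →
      ∀ hs : List D, hs.length + gs.length = t →
      ∃ a : K, M * (hs.map φ).prod * (gs.map φ).prod -
        a • (M * (hs.map φ).prod * (Ls.map φ).prod) ∈ I := by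
  intro gs
  induction gs with
  | nil =>
    intro Ls hl _ hs _
    obtain rfl : Ls = [] := by simpa using hl.symm
    exact ⟨1, by simp⟩
  | cons g gs ih =>
    intro Ls hl hL hs ht
    obtain _ | ⟨L, Ls⟩ := Ls
    · simp at hl
    obtain ⟨a, ha⟩ := hL L (by simp) g
    -- `hs` collects the factors already replaced; the error `g - a • L` lies in `H` and is absorbed
    -- by `hM`.
    obtain ⟨c, hc⟩ := ih Ls (by simpa using hl) (fun L' h' => hL L' (by simp [h'])) (L :: hs)
      (by simp at ht ⊢; omega)
    refine ⟨a * c, ?_⟩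
    have h1 := hM _ ha (hs ++ gs) (by simp at ht ⊢; omega)
    have h2 := I.add_mem h1 (I.mul_mem_left (algebraMap K R a) hc)
    convert h2 using 1
    simp only [List.map_cons, List.prod_cons, List.map_append, List.prod_append, map_sub,
      map_smul, Algebra.smul_def, map_mul]
    ring

/-- If every product of `i < m` generators of `H` can be completed by factors outside `H` to
a product of `b` factors in `I`, and products of `m` generators of `H` are in `I`, then all
products of `b` factors are in `I`. -/
theorem prod_mem_of_exists_completion (φ : D →ₗ[K] R) (I : Ideal R) (G : Set D) (b m : ℕ)
    (hm : ∀ fs : List D, (∀ f ∈ fs, f ∈ G) → fs.length = m → (fs.map φ).prod ∈ I)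
    (hstep : ∀ fs : List D, (∀ f ∈ fs, f ∈ G) → fs.length < m → ∃ Ls : List D,
      Ls.length + fs.length = b ∧ (∀ L ∈ Ls, ∀ g, ∃ a : K, g - a • L ∈ Submodule.span K G) ∧
      (fs.map φ).prod * (Ls.map φ).prod ∈ I)
    (gs : List D) (hgs : gs.length = b) : (gs.map φ).prod ∈ I := by
  -- Descending induction on the number of factors from `G`, with `d` of them still missing.
  suffices H : ∀ d : ℕ, ∀ fs : List D, (∀ f ∈ fs, f ∈ G) → fs.length + d = m → ∀ gs : List D,
      gs.length + fs.length = b → (fs.map φ).prod * (gs.map φ).prod ∈ I by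
    simpa using H m [] (by simp) (by simp) gs (by simpa using hgs)
  intro d
  induction d with
  | zero => exact fun fs hfs hl gs _ => I.mul_mem_right _ (hm fs hfs hl)
  | succ d ih =>
    intro fs hfs hl gs hgs
    obtain ⟨Ls, hLl, hL, hmem⟩ := hstep fs hfs (by omega)
    obtain ⟨a, ha⟩ := exists_prod_sub_smul_prod_mem φ I (Submodule.span K G) (fs.map φ).prod
      gs.length (fun h hh gs' hgs' => by
        induction hh using Submodule.span_induction with
        | mem x hx =>
          have := ih (x :: fs) (by simpa using ⟨hx, hfs⟩) (by simp; omega) gs' (by simp; omega)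
          rwa [List.map_cons, List.prod_cons, mul_comm (φ x)] at this
        | zero => simp
        | add x y _ _ hx hy =>
          rw [map_add, mul_add, add_mul]
          exact I.add_mem hx hy
        | smul c x _ hx =>
          rw [map_smul, Algebra.smul_def]
          have := I.mul_mem_left (algebraMap K R c) hx
          convert this using 1
          ring) gs Ls (by omega) hL [] (by simp)
    have h2 := I.add_mem ha (I.mul_mem_left (algebraMap K R a) hmem)
    convert h2 using 1
    simp only [List.map_nil, List.prod_nil, Algebra.smul_def]
    ring

end Exchange

/-! ### From products of linear forms to the regularity index -/

section Regularity

variable {K : Type*} [Field K] {n : ℕ}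

/-- A monomial of degree at least `b` is divisible by a product of `b` variables, which are linear
forms. -/
theorem homogeneous_mem_of_prod_linForm_mem (I : Ideal (MvPolynomial (Fin (n + 1)) K)) (b : ℕ)
    (h : ∀ gs : List (Module.Dual K (Fin (n + 1) → K)), gs.length = b →
      (gs.map (linForm K n)).prod ∈ I)
    {f : MvPolynomial (Fin (n + 1)) K} {u : ℕ} (hu : b ≤ u) (hf : f.IsHomogeneous u) : f ∈ I := by
  rw [f.as_sum]
  refine I.sum_mem fun d hd => ?_
  have hdeg := hf (MvPolynomial.mem_support_iff.1 hd)
  rw [← mul_one (MvPolynomial.coeff d f), ← MvPolynomial.C_mul_monomial]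
  refine I.mul_mem_left _ ?_
  have hl : (Finsupp.toMultiset d).toList.length = u := by
    rw [Multiset.length_toList, Finsupp.card_toMultiset, ← hdeg]
    simp [Finsupp.weight_apply, Finsupp.sum]
  have key : MvPolynomial.monomial d (1 : K) =
      (((Finsupp.toMultiset d).toList).map fun i => linForm K n (LinearMap.proj i)).prod := by
    simp only [linForm_proj]
    rw [← Multiset.prod_coe, ← Multiset.map_coe, Multiset.coe_toList, Finsupp.toMultiset_map,
      Finsupp.prod_toMultiset]
    rw [MvPolynomial.monomial_eq]
    simp [Finsupp.prod_mapDomain_index, pow_add]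
  rw [key, ← List.take_append_drop b (Finsupp.toMultiset d).toList, List.map_append,
    List.prod_append]
  refine I.mul_mem_right _ ?_
  have := h (((Finsupp.toMultiset d).toList.take b).map LinearMap.proj) (by
    rw [List.length_map, List.length_take, hl]
    omega)
  rwa [List.map_map] at this

theorem exists_isRegularityIndex_le (I : Ideal (MvPolynomial (Fin (n + 1)) K)) (b : ℕ)
    (h : ∀ (u : ℕ), b ≤ u → ∀ f : MvPolynomial (Fin (n + 1)) K, f.IsHomogeneous u → f ∈ I) :
    ∃ r, IsRegularityIndex I r ∧ r ≤ b := by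
  have hb : b ∈ {t : ℕ | ∃ H : Polynomial ℚ, ∀ u : ℕ, t ≤ u →
      (hilbertFunction I u : ℚ) = H.eval (u : ℚ)} := by
    refine ⟨0, fun u hu => ?_⟩
    have : (MvPolynomial.homogeneousSubmodule (Fin (n + 1)) K u).map
        (Ideal.Quotient.mkₐ K I).toLinearMap = ⊥ := by
      rw [eq_bot_iff]
      rintro _ ⟨f, hf, rfl⟩
      exact Ideal.Quotient.eq_zero_iff_mem.2
        (h u hu f ((MvPolynomial.mem_homogeneousSubmodule _ _).1 hf))
    rw [hilbertFunction, this, finrank_bot]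
    simp
  exact ⟨_, ⟨Nat.sInf_mem ⟨b, hb⟩, fun _ ht => Nat.sInf_le ht⟩, Nat.sInf_le hb⟩

end Regularity

end FatPoints
namespace FatPoints

/-! ### Combinatorics: pairing points of different classes -/

section Pairing

variable {E κ : Type*} [DecidableEq E] [DecidableEq κ]

/-- If the weight is at least `2 t` in total and at least `t` outside each class, then there are
`t` pairs of elements of different classes which use every element at most `ν e` times. -/
theorem exists_pairing (A : Finset E) (cls : E → κ) (t : ℕ) (ν : E → ℕ)
    (htot : 2 * t ≤ ∑ e ∈ A, ν e) (hcls : ∀ c, t ≤ ∑ e ∈ A with cls e ≠ c, ν e) :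
    ∃ p : List (E × E), p.length = t ∧
      (∀ x ∈ p, x.1 ∈ A ∧ x.2 ∈ A ∧ cls x.1 ≠ cls x.2) ∧
      ∀ e, p.countP (fun x => e = x.1 ∨ e = x.2) ≤ ν e := by
  induction t generalizing ν with
  | zero => exact ⟨[], by simp⟩
  | succ t ih =>
    have split : ∀ (ν : E → ℕ) (B : Finset E) (c : κ),
        ∑ e ∈ B, ν e = (∑ e ∈ B with cls e = c, ν e) + ∑ e ∈ B with cls e ≠ c, ν e :=
      fun ν B c => (Finset.sum_filter_add_sum_filter_not _ _ _).symm
    let w : E → ℕ := fun e => ∑ e' ∈ A with cls e' = cls e, ν e'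
    have hne1 : (A.filter fun e => 0 < ν e).Nonempty := by
      by_contra h0
      rw [Finset.not_nonempty_iff_eq_empty, Finset.filter_eq_empty_iff] at h0
      have : ∑ e ∈ A, ν e = 0 := Finset.sum_eq_zero fun e he => by have := h0 he; omega
      omega
    -- Greedy choice: take one unit from a heaviest class and one from a heaviest other class, then
    -- recurse. Only a third class could violate the bound; it would weigh more than `t`, hence so
    -- would the two chosen ones lying outside it.
    obtain ⟨a, ha, hamax⟩ := Finset.exists_max_image _ w hne1
    have hne2 : (A.filter fun e => 0 < ν e ∧ cls e ≠ cls a).Nonempty := by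
      by_contra h0
      rw [Finset.not_nonempty_iff_eq_empty, Finset.filter_eq_empty_iff] at h0
      have h1 : ∑ e ∈ A with cls e ≠ cls a, ν e = 0 := Finset.sum_eq_zero fun e he => by
        rw [Finset.mem_filter] at he
        have := h0 he.1
        by_contra h2
        exact this ⟨by omega, he.2⟩
      have := hcls (cls a)
      omega
    obtain ⟨b, hb, hbmax⟩ := Finset.exists_max_image _ w hne2
    simp only [Finset.mem_filter] at ha hb hamax hbmax
    have hab : a ≠ b := fun h => hb.2.2 (by rw [h])
    let ν' : E → ℕ := fun e => ν e - (if e = a then 1 else 0) - (if e = b then 1 else 0)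
    have hν' : ∀ e, ν e = ν' e + (if e = a then 1 else 0) + (if e = b then 1 else 0) := by
      intro e
      simp only [ν']
      by_cases h1 : e = a
      · subst h1
        simp [hab]; omega
      · by_cases h2 : e = b
        · subst h2
          simp [h1]; omega
        · simp [h1, h2]
    have hsum : ∀ B : Finset E, ∑ e ∈ B, ν e =
        (∑ e ∈ B, ν' e) + (if a ∈ B then 1 else 0) + (if b ∈ B then 1 else 0) := by
      intro B
      rw [Finset.sum_congr rfl fun e _ => hν' e, Finset.sum_add_distrib, Finset.sum_add_distrib]
      simp
    obtain ⟨p, hp1, hp2, hp3⟩ := ih ν' (by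
        have := hsum A
        simp only [ha.1, hb.1, if_true] at this
        omega) (by
      intro c
      have h1 := hsum (A.filter fun e => cls e ≠ c)
      have h2 := hcls c
      simp only [Finset.mem_filter, ha.1, hb.1, true_and] at h1
      by_cases hca : cls a = c
      · have : ¬ (cls a ≠ c) := by simpa using hca
        rw [if_neg this] at h1
        split_ifs at h1 <;> omega
      by_cases hcb : cls b = c
      · have : ¬ (cls b ≠ c) := by simpa using hcb
        rw [if_neg this] at h1
        split_ifs at h1 <;> omega
      rw [if_pos hca, if_pos hcb] at h1
      by_contra hlt
      have h3 := split ν A c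
      -- the class `c` weighs at least `t + 1`, hence so do those of `a` and `b`
      have hc : t + 1 ≤ ∑ e ∈ A with cls e = c, ν e := by omega
      obtain ⟨x, hx, hx0⟩ : ∃ x ∈ A.filter fun e => cls e = c, ν x ≠ 0 := by
        by_contra! h0
        rw [Finset.sum_eq_zero h0] at hc
        omega
      rw [Finset.mem_filter] at hx
      obtain ⟨hxA, rfl⟩ := hx
      have hb1 := hbmax x ⟨hxA, by omega, fun h => hca h.symm⟩
      have ha1 := hamax b ⟨hb.1, hb.2.1⟩
      have h4 : w a + w b ≤ ∑ e ∈ A with cls e ≠ cls x, ν e := by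
        simp only [w]
        rw [← Finset.sum_union]
        · refine Finset.sum_le_sum_of_subset fun e => ?_
          simp only [Finset.mem_union, Finset.mem_filter]
          rintro (⟨h, h'⟩ | ⟨h, h'⟩)
          · exact ⟨h, h' ▸ hca⟩
          · exact ⟨h, h' ▸ hcb⟩
        · rw [Finset.disjoint_filter]
          intro e _ h h'
          exact hb.2.2 (h'.symm.trans h)
      have h5 : t + 1 ≤ w x := hc
      omega)
    refine ⟨(a, b) :: p, by simp [hp1], ?_, fun e => ?_⟩
    · simpa using ⟨⟨ha.1, hb.1, fun h => hb.2.2 h.symm⟩, fun x y h => hp2 (x, y) h⟩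
    · rw [List.countP_cons]
      have := hp3 e
      simp only [Bool.decide_or] at this
      have h2 := hν' e
      by_cases h3 : e = a
      · subst h3; simp [hab] at h2 ⊢; omega
      · by_cases h4 : e = b
        · subst h4; simp [h3] at h2 ⊢; omega
        · simp [h3, h4] at h2 ⊢; omega

theorem sum_countP_le {α : Type*} (F : α → Finset E) (A : Finset E) (r : ℕ) (l : List α)
    (h : ∀ x ∈ l, (A.filter fun e => e ∈ F x).card ≤ r) :
    ∑ e ∈ A, l.countP (fun x => e ∈ F x) ≤ r * l.length := by
  induction l with
  | nil => simp
  | cons x l ih =>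
    simp only [List.countP_cons, Finset.sum_add_distrib, List.length_cons, mul_add, mul_one]
    refine add_le_add (ih fun y hy => h y (by simp [hy])) ?_
    have := h x (by simp)
    rw [Finset.card_filter] at this
    simpa using this

/-- Double counting: each `x ∈ l` removes at most `r` units of weight, and truncation of the
subtraction only helps. -/
theorem card_mul_le_sum_sub_countP {α : Type*} (F : α → Finset E) (A : Finset E) (r N : ℕ)
    (l : List α) (h : ∀ x ∈ l, (A.filter fun e => e ∈ F x).card ≤ r) :
    A.card * N ≤ (∑ e ∈ A, (N - l.countP (fun x => e ∈ F x))) + r * l.length := by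
  refine le_trans ?_ (Nat.add_le_add_left (sum_countP_le F A r l h) _)
  rw [← Finset.sum_add_distrib, ← smul_eq_mul, ← Finset.sum_const]
  exact Finset.sum_le_sum fun e _ => by omega

/-- Taking `y` and `z` from the two largest classes, not counting `P`, bounds every other class by
that of `z`; the tight case of `weight_bounds` needs this. -/
theorem exists_max_class_pair (A : Finset E) (cls : E → κ) (P : E)
    (hq : ∀ x ∈ A, 3 ≤ (A.filter fun e => cls e ≠ cls x).card) (hA : 2 ≤ A.card) :
    ∃ y ∈ A, ∃ z ∈ A, y ≠ P ∧ z ≠ P ∧ cls y ≠ cls z ∧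
      (∀ x ∈ A, x ≠ P → (A.filter fun e => e ≠ P ∧ cls e = cls x).card ≤
        (A.filter fun e => e ≠ P ∧ cls e = cls y).card) ∧
      ∀ x ∈ A, x ≠ P → cls x ≠ cls y → (A.filter fun e => e ≠ P ∧ cls e = cls x).card ≤
        (A.filter fun e => e ≠ P ∧ cls e = cls z).card := by
  have h1 : (A.erase P).Nonempty := by
    rw [← Finset.card_pos]
    have := Finset.pred_card_le_card_erase (s := A) (a := P)
    omega
  obtain ⟨y, hy, hymax⟩ := Finset.exists_max_image _
    (fun x => (A.filter fun e => e ≠ P ∧ cls e = cls x).card) h1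
  rw [Finset.mem_erase] at hy
  have h2 : ((A.filter fun e => cls e ≠ cls y).erase P).Nonempty := by
    rw [← Finset.card_pos]
    have := Finset.pred_card_le_card_erase (s := A.filter fun e => cls e ≠ cls y) (a := P)
    have := hq y hy.2
    omega
  obtain ⟨z, hz, hzmax⟩ := Finset.exists_max_image _
    (fun x => (A.filter fun e => e ≠ P ∧ cls e = cls x).card) h2
  simp only [Finset.mem_erase, Finset.mem_filter] at hz hymax hzmax
  exact ⟨y, hy.2, z, hz.2.1, hy.1, hz.1, fun h => hz.2.2 h.symm,
    fun x hx hxP => hymax x ⟨hxP, hx⟩, fun x hx hxP hxy => hzmax x ⟨hxP, hx, hxy⟩⟩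

/-- The weights `N - #{x ∈ l | e ∈ F x}` satisfy the hypotheses of `exists_pairing`. -/
theorem weight_bounds {α : Type*} (A : Finset E) (cls : E → κ) (P y z : E) (N m : ℕ)
    (hyA : y ∈ A) (hzA : z ∈ A) (hyP : y ≠ P) (hzP : z ≠ P) (hyz : cls y ≠ cls z)
    (hymax : ∀ x ∈ A, x ≠ P → (A.filter fun e => e ≠ P ∧ cls e = cls x).card ≤
        (A.filter fun e => e ≠ P ∧ cls e = cls y).card)
    (hzmax : ∀ x ∈ A, x ≠ P → cls x ≠ cls y → (A.filter fun e => e ≠ P ∧ cls e = cls x).card ≤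
        (A.filter fun e => e ≠ P ∧ cls e = cls z).card)
    (hq : ∀ x ∈ A, 3 ≤ (A.filter fun e => cls e ≠ cls x).card)
    (hqN : ∀ x ∈ A, 2 * m ≤ ((A.filter fun e => cls e ≠ cls x).card - 2) * N + 1)
    (hA : 4 ≤ A.card) (hAN : 3 * m ≤ (A.card - 3) * N + 1) (hN : m ≤ N + 1)
    (hP : P ∈ A → ∃ x ∈ A, x ≠ P ∧ 2 ≤ (A.filter fun e => e ≠ P ∧ cls e = cls x).card)
    (F : α → Finset E) (l : List α) (hl : l.length < m)
    (hF : ∀ x ∈ l, ∃ k, k ≠ P ∧ ∀ e ∈ F x, e = k ∨ (e = y ∧ k ∈ A ∧ cls k ≠ cls z) ∨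
      (e = z ∧ k ∈ A ∧ cls k ≠ cls y)) :
    2 * (N + m - l.length) ≤ ∑ e ∈ A.erase P, (N - l.countP (fun x => e ∈ F x)) ∧
    ∀ c, N + m - l.length ≤
      ∑ e ∈ (A.erase P).filter (fun e => cls e ≠ c), (N - l.countP (fun x => e ∈ F x)) := by
  have three : ∀ B : Finset E, ∀ x ∈ l, (B.filter fun e => e ∈ F x).card ≤ 3 := by
    intro B x hx
    obtain ⟨k, -, hk⟩ := hF x hx
    refine (Finset.card_le_card (t := {k, y, z}) fun e he => ?_).trans Finset.card_le_three
    have := hk e (Finset.mem_filter.1 he).2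
    simp only [Finset.mem_insert, Finset.mem_singleton]
    tauto
  have hA1 := Finset.pred_card_le_card_erase (s := A) (a := P)
  obtain ⟨q, hqA⟩ : ∃ q, A.card = q + 4 := ⟨A.card - 4, by omega⟩
  have htot : 2 * (N + m - l.length) ≤
      ∑ e ∈ A.erase P, (N - l.countP (fun x => e ∈ F x)) := by
    have h1 := card_mul_le_sum_sub_countP F (A.erase P) 3 N l (three _)
    have h2 : (q + 3) * N ≤ (A.erase P).card * N := Nat.mul_le_mul_right _ (by omega)
    rw [hqA, show q + 4 - 3 = q + 1 by omega] at hAN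
    have h3 : (q + 3) * N = (q + 1) * N + 2 * N := by ring
    omega
  refine ⟨htot, fun c => ?_⟩
  by_cases hc : ∃ x ∈ A, cls x = c
  swap
  · have : (A.erase P).filter (fun e => cls e ≠ c) = A.erase P :=
      Finset.filter_true_of_mem fun e he h => hc ⟨e, Finset.mem_of_mem_erase he, h⟩
    rw [this]
    omega
  obtain ⟨x, hxA, rfl⟩ := hc
  set S := A.filter fun e => cls e ≠ cls x with hS
  have hSe : (A.erase P).filter (fun e => cls e ≠ cls x) = S.erase P := by
    rw [hS, Finset.filter_erase]
  rw [hSe]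
  obtain ⟨r, hr⟩ : ∃ r, S.card = r + 3 := ⟨S.card - 3, by have := hq x hxA; rw [← hS] at this; omega⟩
  have hrN := hqN x hxA
  rw [← hS, hr, show r + 3 - 2 = r + 1 by omega] at hrN
  by_cases hPS : P ∈ S
  swap
  · rw [Finset.erase_eq_of_notMem hPS]
    have h1 := card_mul_le_sum_sub_countP F S 3 N l (three _)
    rw [hr, show (r + 3) * N = (r + 1) * N + 2 * N by ring] at h1
    omega
  have hSP : (S.erase P).card = r + 2 := by rw [Finset.card_erase_of_mem hPS]; omega
  have hPA : P ∈ A := (Finset.mem_filter.1 hPS).1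
  have hPx : cls P ≠ cls x := (Finset.mem_filter.1 hPS).2
  by_cases htwo : ∀ a ∈ l, ((S.erase P).filter fun e => e ∈ F a).card ≤ 2
  · have h1 := card_mul_le_sum_sub_countP F (S.erase P) 2 N l htwo
    rw [hSP, show (r + 2) * N = (r + 1) * N + N by ring] at h1
    omega
  -- Remaining case: some `F a` has three points in `S.erase P`. These are `k, y, z`, in three
  -- classes all different from that of `x`.
  push Not at htwo
  obtain ⟨a, hal, ha⟩ := htwo
  have h1 := card_mul_le_sum_sub_countP F (S.erase P) 3 N l (three _)
  rw [hSP] at h1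
  have hl0 : 0 < l.length := List.length_pos_of_mem hal
  obtain ⟨k, hkP, hk⟩ := hF a hal
  have hsub : (S.erase P).filter (fun e => e ∈ F a) ⊆ {k, y, z} := fun e he => by
    have := hk e (Finset.mem_filter.1 he).2
    simp only [Finset.mem_insert, Finset.mem_singleton]
    tauto
  have heq := Finset.eq_of_subset_of_card_le hsub (Finset.card_le_three.trans ha)
  have hmem : ∀ e ∈ ({k, y, z} : Finset E), e ∈ A ∧ cls e ≠ cls x ∧ e ∈ F a := by
    intro e he
    rw [← heq, Finset.mem_filter, Finset.mem_erase, hS, Finset.mem_filter] at he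
    exact ⟨he.1.2.1, he.1.2.2, he.2⟩
  have hcard3 : ({k, y, z} : Finset E).card = 3 :=
    le_antisymm Finset.card_le_three (by rw [← heq]; omega)
  have hky : k ≠ y := by
    rintro rfl
    have := Finset.card_le_two (a := k) (b := z)
    simp at hcard3; omega
  have hkz : k ≠ z := by
    rintro rfl
    have := Finset.card_le_two (a := y) (b := k)
    rw [Finset.insert_comm, Finset.insert_eq_of_mem (Finset.mem_singleton_self k)] at hcard3
    omega
  have hkA := (hmem k (by simp)).1
  have hkx := (hmem k (by simp)).2.1
  have hyx := (hmem y (by simp)).2.1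
  have hzx := (hmem z (by simp)).2.1
  have hkclz : cls k ≠ cls z := by
    rcases hk y (hmem y (by simp)).2.2 with h | h | h
    · exact absurd h.symm hky
    · exact h.2.2
    · exact absurd (congrArg cls h.1) hyz
  have hkcly : cls k ≠ cls y := by
    rcases hk z (hmem z (by simp)).2.2 with h | h | h
    · exact absurd h.symm hkz
    · exact absurd (congrArg cls h.1).symm hyz
    · exact h.2.2
  -- `S` contains the classes of `y` and `z`, the point `k`, and `P`
  set Y := A.filter fun e => e ≠ P ∧ cls e = cls y with hY
  set Z := A.filter fun e => e ≠ P ∧ cls e = cls z with hZ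
  have hYZ : Disjoint Y Z := by
    rw [hY, hZ, Finset.disjoint_filter]
    exact fun e _ h h' => hyz (h.2.symm.trans h'.2)
  have hunion : Y.card + Z.card + 1 ≤ r + 2 := by
    rw [← Finset.card_union_of_disjoint hYZ, ← hSP, ← Finset.card_insert_of_notMem (a := k)]
    · refine Finset.card_le_card fun e he => ?_
      simp only [hY, hZ, Finset.mem_insert, Finset.mem_union, Finset.mem_filter] at he
      rw [Finset.mem_erase, hS, Finset.mem_filter]
      rcases he with rfl | ⟨h1, h2, h3⟩ | ⟨h1, h2, h3⟩
      · exact ⟨hkP, hkA, hkx⟩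
      · exact ⟨h2, h1, h3 ▸ hyx⟩
      · exact ⟨h2, h1, h3 ▸ hzx⟩
    · simp only [hY, hZ, Finset.mem_union, Finset.mem_filter]
      tauto
  obtain ⟨x₁, hx₁, hx₁P, hx₁2⟩ := hP hPA
  have hY2 : 2 ≤ Y.card := hx₁2.trans (hymax x₁ hx₁ hx₁P)
  have hxP : x ≠ P := fun h => hPx (by rw [h])
  have hxZ := hzmax x hxA hxP (fun h => hyx h.symm)
  have hX : A.card = S.card + (A.filter fun e => e ≠ P ∧ cls e = cls x).card := by
    have h2 := Finset.card_filter_add_card_filter_not (s := A) (fun e => cls e ≠ cls x)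
    rw [← h2, hS]
    congr 2
    refine Finset.filter_congr fun e _ => ?_
    simp only [not_not]
    exact ⟨fun h => ⟨fun h' => hPx (h' ▸ h), h⟩, fun h => h.2⟩
  have hZ1 : 1 ≤ Z.card := Finset.card_pos.2 ⟨z, by simp [hZ, hzA, hzP]⟩
  have hmul : ∀ d, d ≤ r + 2 → d * N ≤ (r + 2) * N := fun d hd => Nat.mul_le_mul_right _ hd
  -- The goal needs `(r + 1) * N ≥ m + 2 * l.length`. The list is nonempty, so `m ≥ 2`, and `N ≥ m -
  -- 1` is enough when `r ≥ 3`.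
  by_cases hr3 : 3 ≤ r
  · have := hmul 5 (by omega)
    omega
  have hr2 : r = 2 := by omega
  subst hr2
  -- For `N = m - 1` the count could be one short. But then `Z`, and with it the class of `x`, has
  -- at most one point, so `A.card ≤ 6`, against `hAN`.
  by_cases hNm : m ≤ N
  · omega
  have hZ1' : Z.card = 1 := by omega
  have hq2 : q ≤ 2 := by omega
  have : (A.card - 3) * N ≤ 3 * N := Nat.mul_le_mul_right _ (by omega)
  omega

end Pairing

end FatPoints
namespace FatPoints

/-! ### Relations among the points and sparse functionals -/

section Relations

variable {K V ι : Type*} [Field K] [AddCommGroup V] [Module K V]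

theorem exists_le_finrank_eq [FiniteDimensional K V] (L : Submodule K V) (r : ℕ)
    (h₁ : Module.finrank K L ≤ r) (h₂ : r ≤ Module.finrank K V) :
    ∃ L' : Submodule K V, L ≤ L' ∧ Module.finrank K L' = r := by
  induction r, h₁ using Nat.le_induction with
  | base => exact ⟨L, le_rfl, rfl⟩
  | succ r _ ih =>
    obtain ⟨L', hL, hr⟩ := ih (by omega)
    obtain ⟨x, -, hx⟩ : ∃ x ∈ (⊤ : Submodule K V), x ∉ L' := by
      refine SetLike.exists_of_lt (lt_top_iff_ne_top.2 fun h => ?_)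
      rw [h, finrank_top] at hr
      omega
    refine ⟨L' ⊔ K ∙ x, hL.trans le_sup_left, le_antisymm ?_ ?_⟩
    · refine (Submodule.finrank_add_le_finrank_add_finrank _ _).trans ?_
      rw [hr]
      exact Nat.add_le_add_left ((finrank_span_le_card _).trans (by simp)) _
    · rw [Nat.succ_le_iff, ← hr]
      refine Submodule.finrank_lt_finrank_of_lt (lt_of_le_of_ne le_sup_left fun h => hx ?_)
      rw [h]
      exact Submodule.mem_sup_right (Submodule.mem_span_singleton_self x)

theorem finrank_span_image_le_card [DecidableEq ι] (v : ι → V) (S T : Finset ι)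
    (h : ∀ e ∈ S, v e ∈ Submodule.span K (v '' T)) :
    Module.finrank K (Submodule.span K (v '' S)) ≤ T.card := by
  classical
  have hle : Submodule.span K (v '' (S : Set ι)) ≤ Submodule.span K (v '' (T : Set ι)) :=
    Submodule.span_le.2 (by rintro _ ⟨e, he, rfl⟩; exact h e he)
  have : FiniteDimensional K (Submodule.span K (v '' (T : Set ι))) :=
    FiniteDimensional.span_of_finite K (T.finite_toSet.image v)
  refine (Submodule.finrank_mono hle).trans ?_
  rw [← Finset.coe_image]
  exact (finrank_span_finset_le_card _).trans Finset.card_image_le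

theorem mem_span_of_relation [Fintype ι] [DecidableEq ι] (v : ι → V) (c : ι → K)
    (hc : ∑ e, c e • v e = 0) (T : Finset ι) (y : ι) (hy : c y ≠ 0)
    (hT : ∀ e, c e ≠ 0 → e = y ∨ e ∈ T) : v y ∈ Submodule.span K (v '' T) := by
  rw [← Finset.add_sum_erase _ _ (Finset.mem_univ y)] at hc
  have h1 : v y = -((c y)⁻¹ • ∑ e ∈ Finset.univ.erase y, c e • v e) := by
    rw [eq_neg_of_add_eq_zero_right hc, smul_neg, neg_neg, smul_smul, inv_mul_cancel₀ hy, one_smul]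
  rw [h1]
  refine Submodule.neg_mem _ (Submodule.smul_mem _ _ (Submodule.sum_mem _ fun e he => ?_))
  by_cases h : c e = 0
  · simp [h]
  · refine Submodule.smul_mem _ _ (Submodule.subset_span ⟨e, ?_, rfl⟩)
    exact (hT e h).resolve_left (Finset.ne_of_mem_erase he)

/-- The support of a nonzero relation among vectors, no two of which are proportional, has at
least three elements. -/
theorem three_le_card_support [Fintype ι] [DecidableEq ι] (v : ι → V) (h0 : ∀ e, v e ≠ 0)
    (hv : ∀ e e', e ≠ e' → ∀ a : K, v e ≠ a • v e') (c : ι → K) (hc : ∑ e, c e • v e = 0)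
    (S : Finset ι) (hS : ∀ e, c e ≠ 0 → e ∈ S) (y : ι) (hy : c y ≠ 0) : 3 ≤ S.card := by
  by_contra hlt
  have hyS := hS y hy
  have hmem := mem_span_of_relation v c hc (S.erase y) y hy (fun e he => by
    by_cases h : e = y
    · exact Or.inl h
    · exact Or.inr (Finset.mem_erase.2 ⟨h, hS e he⟩))
  have h1 : (S.erase y).card ≤ 1 := by rw [Finset.card_erase_of_mem hyS]; omega
  rcases Nat.le_one_iff_eq_zero_or_eq_one.1 h1 with h | h
  · rw [Finset.card_eq_zero] at h
    exact h0 y (by simpa [h] using hmem)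
  · obtain ⟨x, hx⟩ := Finset.card_eq_one.1 h
    rw [hx, Finset.coe_singleton, Set.image_singleton, Submodule.mem_span_singleton] at hmem
    obtain ⟨a, ha⟩ := hmem
    have hxy : x ∈ S.erase y := by simp [hx]
    exact hv y x (Finset.ne_of_mem_erase hxy).symm a ha.symm

/-- The `2 × 2` minors of a pair of vectors `w₁`, `w₂`. -/
def minor (w₁ w₂ : ι → K) (e f : ι) : K := w₁ e * w₂ f - w₂ e * w₁ f

theorem minor_self (w₁ w₂ : ι → K) (e : ι) : minor w₁ w₂ e e = 0 := by
  simp [minor, mul_comm]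

theorem minor_swap (w₁ w₂ : ι → K) (e f : ι) : minor w₁ w₂ f e = -minor w₁ w₂ e f := by
  simp only [minor]; ring

/-- A label for the class of `e`: proportional nonzero pairs `(w₁ e, w₂ e)` share a label. -/
noncomputable def ratio [DecidableEq K] (w₁ w₂ : ι → K) (e : ι) : Option K :=
  if w₁ e = 0 then none else some (w₂ e / w₁ e)

theorem ratio_eq_iff [DecidableEq K] (w₁ w₂ : ι → K) {e f : ι} (he : w₁ e ≠ 0 ∨ w₂ e ≠ 0)
    (hf : w₁ f ≠ 0 ∨ w₂ f ≠ 0) : ratio w₁ w₂ e = ratio w₁ w₂ f ↔ minor w₁ w₂ e f = 0 := by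
  unfold ratio minor
  by_cases h1 : w₁ e = 0 <;> by_cases h2 : w₁ f = 0
  · simp [h1, h2]
  · simp [h1, h2] at he ⊢
    exact he
  · simp [h1, h2] at hf ⊢
    exact hf
  · simp only [h1, h2, if_false, Option.some.injEq]
    rw [div_eq_div_iff h1 h2, sub_eq_zero]
    constructor <;> intro h <;> linear_combination -h

theorem sum_minor_smul [Fintype ι] (v : ι → V) {w₁ w₂ : ι → K} (h₁ : ∑ e, w₁ e • v e = 0)
    (h₂ : ∑ e, w₂ e • v e = 0) (f : ι) : ∑ e, minor w₁ w₂ e f • v e = 0 := by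
  have : ∀ e, minor w₁ w₂ e f • v e = w₂ f • (w₁ e • v e) - w₁ f • (w₂ e • v e) := fun e => by
    rw [minor, sub_smul, smul_smul, smul_smul, mul_comm (w₂ f), mul_comm (w₁ f)]
  simp only [this, Finset.sum_sub_distrib, ← Finset.smul_sum, h₁, h₂, smul_zero, sub_zero]

/-- `w₁`, `w₂` is a basis of the linear relations among the vectors `v e`. -/
structure IsRelationBasis [Fintype ι] (v : ι → V) (w₁ w₂ : ι → K) : Prop where
  rel₁ : ∑ e, w₁ e • v e = 0
  rel₂ : ∑ e, w₂ e • v e = 0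
  exists_minor : ∃ y z, minor w₁ w₂ y z ≠ 0
  exists_coord : ∀ c : ι → K, ∑ e, c e • v e = 0 → ∃ a b : K, ∀ e, c e = a * w₁ e + b * w₂ e

theorem exists_isRelationBasis [Fintype ι] (v : ι → V)
    (h : Module.finrank K (Submodule.span K (Set.range v)) + 2 = Fintype.card ι) :
    ∃ w₁ w₂ : ι → K, IsRelationBasis v w₁ w₂ := by
  let φ : (ι → K) →ₗ[K] V := Fintype.linearCombination K v
  have hker : Module.finrank K (LinearMap.ker φ) = 2 := by
    have h1 := LinearMap.finrank_range_add_finrank_ker φ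
    rw [Fintype.range_linearCombination, Module.finrank_fintype_fun_eq_card] at h1
    omega
  let B := Module.finBasisOfFinrankEq K (LinearMap.ker φ) hker
  have hcoord : ∀ c : ι → K, ∑ e, c e • v e = 0 → ∃ a b : K, ∀ e,
      c e = a * (B 0 : ι → K) e + b * (B 1 : ι → K) e := by
    intro c hc
    let c' : LinearMap.ker φ := ⟨c, by simpa [φ, Fintype.linearCombination_apply] using hc⟩
    refine ⟨B.repr c' 0, B.repr c' 1, fun e => ?_⟩
    have h1 := congrArg (fun x : LinearMap.ker φ => (x : ι → K) e) (B.sum_repr c')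
    simp only [Fin.sum_univ_two] at h1
    simpa [c'] using h1.symm
  have hrel : ∀ i, ∑ e, (B i : ι → K) e • v e = 0 := fun i => by
    have := (B i).2
    rwa [LinearMap.mem_ker, Fintype.linearCombination_apply] at this
  refine ⟨B 0, B 1, hrel 0, hrel 1, ?_, hcoord⟩
  by_contra! hmin
  have hli := B.linearIndependent
  rw [show ⇑B = ![B 0, B 1] from funext fun i => by fin_cases i <;> rfl,
    LinearIndependent.pair_iff' (B.ne_zero 0)] at hli
  obtain ⟨y, hy⟩ : ∃ y, (B 0 : ι → K) y ≠ 0 := by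
    by_contra! h0
    exact B.ne_zero 0 (Subtype.ext (funext h0))
  refine hli ((B 1 : ι → K) y / (B 0 : ι → K) y) (Subtype.ext (funext fun z => ?_))
  have := hmin y z
  simp only [minor] at this
  simp only [Submodule.coe_smul, Pi.smul_apply, smul_eq_mul]
  field_simp
  linear_combination -this

/-- A relation supported off `y` and `z` is `a w₁ + b w₂` vanishing at both, so the nonzero minor
forces `a = b = 0`: the other vectors are independent. -/
theorem IsRelationBasis.exists_dual [Fintype ι] [DecidableEq ι] {v : ι → V} {w₁ w₂ : ι → K}
    (hw : IsRelationBasis v w₁ w₂) {y z k : ι} (hyz : minor w₁ w₂ y z ≠ 0) (hky : k ≠ y)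
    (hkz : k ≠ z) :
    ∃ f : Module.Dual K V, f (v k) = 1 ∧ ∀ e, e ≠ k → e ≠ y → e ≠ z → f (v e) = 0 := by
  let u : {e // e ≠ y ∧ e ≠ z} → V := fun e => v e
  have hu : LinearIndependent K u := by
    rw [Fintype.linearIndependent_iff]
    intro g hg
    let c : ι → K := fun e => if h : e ≠ y ∧ e ≠ z then g ⟨e, h⟩ else 0
    have hc : ∑ e, c e • v e = 0 := by
      rw [← hg, ← Fintype.sum_subtype_add_sum_subtype (fun e => e ≠ y ∧ e ≠ z),
        Finset.sum_eq_zero (s := (Finset.univ : Finset {e // ¬(e ≠ y ∧ e ≠ z)})), add_zero]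
      · exact Finset.sum_congr rfl fun e _ => by simp only [c, dif_pos e.2, u]
      · intro e _
        simp only [c, dif_neg e.2, zero_smul]
    obtain ⟨a, b, hab⟩ := hw.exists_coord c hc
    have hy := hab y
    have hz := hab z
    simp only [c, ne_eq, not_true_eq_false, false_and, and_false, dite_false] at hy hz
    have ha : a = 0 := by
      have : a * minor w₁ w₂ y z = 0 := by
        simp only [minor]; linear_combination w₂ y * hz - w₂ z * hy
      exact (mul_eq_zero.1 this).resolve_right hyz
    have hb : b = 0 := by
      have : b * minor w₁ w₂ y z = 0 := by
        simp only [minor]; linear_combination w₁ z * hy - w₁ y * hz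
      exact (mul_eq_zero.1 this).resolve_right hyz
    intro i
    have := hab i
    simpa [c, ha, hb, i.2.1, i.2.2] using this
  obtain ⟨g, hg⟩ := LinearMap.exists_leftInverse_of_injective (Finsupp.linearCombination K u)
    (LinearMap.ker_eq_bot.2 hu)
  have hgu : ∀ e, g (u e) = Finsupp.single e 1 := fun e => by
    have := LinearMap.congr_fun hg (Finsupp.single e 1)
    simpa using this
  refine ⟨Finsupp.lapply ⟨k, hky, hkz⟩ ∘ₗ g, ?_, fun e hek hey hez => ?_⟩
  · have := hgu ⟨k, hky, hkz⟩
    simp only [u] at this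
    simp [this]
  · have := hgu ⟨e, hey, hez⟩
    simp only [u] at this
    simp [this, hek]

/-- Apply `f` to the relation with coefficients `minor w₁ w₂ e z`, in which the term at `z` drops
out. -/
theorem IsRelationBasis.apply_relation [Fintype ι] [DecidableEq ι] {v : ι → V} {w₁ w₂ : ι → K}
    (hw : IsRelationBasis v w₁ w₂) {y z k : ι} (hky : k ≠ y)
    (f : Module.Dual K V) (hf : ∀ e, e ≠ k → e ≠ y → e ≠ z → f (v e) = 0) :
    minor w₁ w₂ y z * f (v y) = -(minor w₁ w₂ k z * f (v k)) := by
  have h := congrArg f (sum_minor_smul v hw.rel₁ hw.rel₂ z)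
  rw [map_sum, map_zero, ← Finset.add_sum_erase _ _ (Finset.mem_univ y),
    ← Finset.add_sum_erase _ _ (Finset.mem_erase.2 ⟨hky, Finset.mem_univ k⟩),
    Finset.sum_eq_zero (fun e he => ?_)] at h
  · simp only [map_smul, smul_eq_mul] at h
    linear_combination h
  · simp only [Finset.mem_erase, Finset.mem_univ, and_true] at he
    rw [map_smul, smul_eq_mul]
    by_cases hez : e = z
    · rw [hez, minor_self, zero_mul]
    · rw [hf e he.1 he.2 hez, mul_zero]

/-- Functionals vanishing at `v p` and at all other `v e`, except at `v k` for one index `k`,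
and at `v y` and `v z` subject to a condition on `k`. -/
def sparseForms (v : ι → V) (w₁ w₂ : ι → K) (p y z : ι) : Set (Module.Dual K V) :=
  {f | f (v p) = 0 ∧ ∃ k, k ≠ p ∧ ∀ e, f (v e) ≠ 0 →
    e = k ∨ (e = y ∧ minor w₁ w₂ k z ≠ 0) ∨ (e = z ∧ minor w₁ w₂ k y ≠ 0)}

theorem IsRelationBasis.mem_span_sparseForms [Fintype ι] [DecidableEq ι] {v : ι → V}
    {w₁ w₂ : ι → K} (hw : IsRelationBasis v w₁ w₂) {p y z : ι} (hyz : minor w₁ w₂ y z ≠ 0)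
    (hpy : y ≠ p) (hpz : z ≠ p) (f : Module.Dual K V) (hf : f (v p) = 0) :
    f ∈ Submodule.span K (sparseForms v w₁ w₂ p y z) := by
  have hzy : minor w₁ w₂ z y ≠ 0 := by rw [minor_swap]; exact neg_ne_zero.2 hyz
  have hex : ∀ k, ∃ l : Module.Dual K V, k ≠ y → k ≠ z →
      (l (v k) = 1 ∧ ∀ e, e ≠ k → e ≠ y → e ≠ z → l (v e) = 0) := by
    intro k
    by_cases h : k ≠ y ∧ k ≠ z
    · obtain ⟨l, hl⟩ := hw.exists_dual hyz h.1 h.2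
      exact ⟨l, fun _ _ => hl⟩
    · exact ⟨0, fun h1 h2 => absurd ⟨h1, h2⟩ h⟩
  choose l hl using hex
  let S : Finset ι := Finset.univ.filter fun k => k ≠ p ∧ k ≠ y ∧ k ≠ z
  have hS : ∀ k ∈ S, k ≠ p ∧ k ≠ y ∧ k ≠ z := fun k hk => (Finset.mem_filter.1 hk).2
  let g : Module.Dual K V := f - ∑ k ∈ S, f (v k) • l k
  have hfg : f = g + ∑ k ∈ S, f (v k) • l k := by simp [g]
  have hg0 : ∀ e, e ≠ y → e ≠ z → g (v e) = 0 := by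
    intro e hey hez
    have h1 : ∀ k ∈ S, k ≠ e → l k (v e) = 0 := fun k hk hke =>
      (hl k (hS k hk).2.1 (hS k hk).2.2).2 e hke.symm hey hez
    simp only [g, LinearMap.sub_apply, LinearMap.sum_apply, LinearMap.smul_apply, smul_eq_mul]
    by_cases hep : e = p
    · subst hep
      rw [hf, Finset.sum_eq_zero fun k hk => ?_, sub_zero]
      rw [h1 k hk (hS k hk).1, mul_zero]
    · rw [Finset.sum_eq_single e (fun k hk hke => by rw [h1 k hk hke, mul_zero])
        (fun h => absurd (Finset.mem_filter.2 ⟨Finset.mem_univ e, hep, hey, hez⟩) h),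
        (hl e hey hez).1, mul_one, sub_self]
  have hgy : g (v y) = 0 := by
    have := hw.apply_relation hpy.symm g (fun e _ h2 h3 => hg0 e h2 h3)
    rw [hg0 p hpy.symm hpz.symm, mul_zero, neg_zero] at this
    exact (mul_eq_zero.1 this).resolve_left hyz
  have hgz : g (v z) = 0 := by
    have := hw.apply_relation hpz.symm g (fun e _ h2 h3 => hg0 e h3 h2)
    rw [hg0 p hpy.symm hpz.symm, mul_zero, neg_zero] at this
    exact (mul_eq_zero.1 this).resolve_left hzy
  have hgall : ∀ e, g (v e) = 0 := fun e => by
    by_cases h1 : e = y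
    · rw [h1, hgy]
    · by_cases h2 : e = z
      · rw [h2, hgz]
      · exact hg0 e h1 h2
  rw [hfg]
  -- `g` kills every `v e` but may be nonzero, as the points need not span `V`; it is sparse with `k
  -- = y` as a dummy index.
  refine Submodule.add_mem _ (Submodule.subset_span ⟨hgall p, y, hpy, fun e he =>
    absurd (hgall e) he⟩) (Submodule.sum_mem _ fun k hk => Submodule.smul_mem _ _
      (Submodule.subset_span ?_))
  obtain ⟨hkp, hky, hkz⟩ := hS k hk
  obtain ⟨hk1, hk0⟩ := hl k hky hkz
  refine ⟨hk0 p hkp.symm hpy.symm hpz.symm, k, hkp, fun e he => ?_⟩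
  by_cases hek : e = k
  · exact Or.inl hek
  refine Or.inr ?_
  by_cases hey : e = y
  · refine Or.inl ⟨hey, fun h => he ?_⟩
    have := hw.apply_relation hky (l k) hk0
    rw [h, zero_mul, neg_zero] at this
    rw [hey]
    exact (mul_eq_zero.1 this).resolve_left hyz
  by_cases hez : e = z
  · refine Or.inr ⟨hez, fun h => he ?_⟩
    have := hw.apply_relation hkz (l k) (fun e h1 h2 h3 => hk0 e h1 h3 h2)
    rw [h, zero_mul, neg_zero] at this
    rw [hez]
    exact (mul_eq_zero.1 this).resolve_left hzy
  exact absurd (hk0 e hek hey hez) he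

end Relations

/-! ### Numerical consequences of the Segre bound -/

section SegreBound

open scoped LinearAlgebra.Projectivization

variable {K : Type*} [Field K] {n : ℕ} {ι : Type*}

theorem card_mul_le_sup_segreT [Fintype ι] [DecidableEq ι] (P : ι → ℙ K (Fin (n + 1) → K))
    (m : ℕ) (S : Finset ι) (hS : S.Nonempty) (j : ℕ) (hj : 1 ≤ j) (hjn : j ≤ n)
    (h : Module.finrank K (Submodule.span K ((fun e => (P e).rep) '' (S : Set ι))) ≤ j + 1) :
    m * S.card ≤ (Finset.Icc 1 n).sup (fun j => segreT P m j) * j + 1 := by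
  obtain ⟨L, hL, hr⟩ := exists_le_finrank_eq _ (j + 1) h (by simpa using hjn)
  have hlie : LieOnLinearSpace P S j := by
    refine ⟨L, hr, fun i hi => ?_⟩
    rw [Projectivization.submodule_eq, Submodule.span_singleton_le_iff_mem]
    exact hL (Submodule.subset_span ⟨i, hi, rfl⟩)
  have h1 : (m * S.card + j - 2) / j ≤ segreT P m j := by
    unfold segreT
    exact Finset.le_sup (f := fun S : Finset ι => (m * S.card + j - 2) / j)
      (by simpa using ⟨hS, hlie⟩)
  have h2 : segreT P m j ≤ (Finset.Icc 1 n).sup (fun j => segreT P m j) :=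
    Finset.le_sup (f := fun j => segreT P m j) (Finset.mem_Icc.2 ⟨hj, hjn⟩)
  have h3 := Nat.lt_succ_of_le (h1.trans h2)
  rw [Nat.div_lt_iff_lt_mul hj, Nat.succ_mul] at h3
  omega

theorem rep_ne_smul_rep {p q : ℙ K (Fin (n + 1) → K)} (h : p ≠ q) (a : K) :
    p.rep ≠ a • q.rep := by
  intro hpq
  refine h ?_
  rw [← p.mk_rep, ← q.mk_rep, Projectivization.mk_eq_mk_iff']
  exact ⟨a, hpq.symm⟩

end SegreBound

end FatPoints

namespace FatPoints

/-! ### Proportionality classes -/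

section Classes

variable {K V ι : Type*} [Field K] [AddCommGroup V] [Module K V]

theorem ne_zero_of_minor_ne_zero {w₁ w₂ : ι → K} {e f : ι} (h : minor w₁ w₂ e f ≠ 0) :
    w₁ e ≠ 0 ∨ w₂ e ≠ 0 := by
  by_contra! h0
  exact h (by simp [minor, h0.1, h0.2])

theorem IsRelationBasis.exists_minor_ne_zero [Fintype ι] {v : ι → V} {w₁ w₂ : ι → K}
    (hw : IsRelationBasis v w₁ w₂) {x : ι} (hx : w₁ x ≠ 0 ∨ w₂ x ≠ 0) :
    ∃ y, minor w₁ w₂ y x ≠ 0 := by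
  obtain ⟨a, b, hab⟩ := hw.exists_minor
  by_contra! h
  have ha := h a
  have hb := h b
  simp only [minor] at ha hb hab
  rcases hx with hx | hx <;> refine hab ((mul_eq_zero.1 ?_).resolve_right hx)
  · linear_combination w₁ b * ha - w₁ a * hb
  · linear_combination w₂ b * ha - w₂ a * hb

/-- If the vectors indexed by `S` lie in a space of dimension less than the size of `S`, then any
two indices outside `S` have proportional pairs `(w₁, w₂)`. -/
theorem IsRelationBasis.minor_eq_zero_of_notMem [Fintype ι] [DecidableEq ι] {v : ι → V}
    {w₁ w₂ : ι → K} (hw : IsRelationBasis v w₁ w₂) (L : Submodule K V) [FiniteDimensional K L]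
    (S : Finset ι) (hS : ∀ e ∈ S, v e ∈ L) (hL : Module.finrank K L < S.card) {x y : ι}
    (hx : x ∉ S) (hy : y ∉ S) : minor w₁ w₂ x y = 0 := by
  have hli : ¬ LinearIndependent K (fun e : S => (⟨v e, hS e e.2⟩ : L)) := fun h => by
    have := h.fintype_card_le_finrank
    rw [Fintype.card_coe] at this
    omega
  rw [Fintype.not_linearIndependent_iff] at hli
  obtain ⟨g, hg, i, hi⟩ := hli
  let c : ι → K := fun e => if h : e ∈ S then g ⟨e, h⟩ else 0
  have hc : ∑ e, c e • v e = 0 := by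
    have h1 := congrArg (Subtype.val : L → V) hg
    rw [← Fintype.sum_subtype_add_sum_subtype (fun e => e ∈ S),
      Finset.sum_eq_zero (s := (Finset.univ : Finset {e // ¬ e ∈ S})), add_zero]
    · rw [Submodule.coe_sum] at h1
      rw [← Submodule.coe_zero (p := L), ← h1]
      exact Finset.sum_congr (by ext; simp) fun e _ => by
        simp only [c, dif_pos e.2, Submodule.coe_smul]
    · intro e _
      simp only [c, dif_neg e.2, zero_smul]
  obtain ⟨a, b, hab⟩ := hw.exists_coord c hc
  have h1 := hab x
  have h2 := hab y
  have h3 := hab i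
  simp only [c, hx, hy, i.2, dif_pos, dif_neg, not_false_eq_true] at h1 h2 h3
  by_contra hm
  have ha : a = 0 := by
    have : a * minor w₁ w₂ x y = 0 := by
      simp only [minor]; linear_combination w₂ x * h2 - w₂ y * h1
    exact (mul_eq_zero.1 this).resolve_right hm
  have hb : b = 0 := by
    have : b * minor w₁ w₂ x y = 0 := by
      simp only [minor]; linear_combination w₁ y * h1 - w₁ x * h2
    exact (mul_eq_zero.1 this).resolve_right hm
  exact hi (by rw [h3, ha, hb, zero_mul, zero_mul, add_zero])

end Classes

/-! ### Completing a product to an element of `J` -/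

section Completion

open scoped LinearAlgebra.Projectivization

variable {K : Type*} [Field K] {n : ℕ} {ι : Type*} [Fintype ι] [DecidableEq ι]

theorem prod_mem_pointIdeal_pow [DecidableEq K] (p : ℙ K (Fin (n + 1) → K))
    (fs : List (Module.Dual K (Fin (n + 1) → K))) :
    (fs.map (linForm K n)).prod ∈ pointIdeal p ^ fs.countP (fun f => f p.rep = 0) :=
  list_prod_mem_pow_countP (pointIdeal p) (linForm K n) (fun f => f p.rep = 0)
    (fun _ => linForm_mem_pointIdeal) fs

/-- Pairs of indices with nonvanishing minors, used sparingly, yield products of linear forms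
vanishing to the right order. -/
theorem exists_completion [DecidableEq K] (P : ι → ℙ K (Fin (n + 1) → K)) {w₁ w₂ : ι → K}
    (hw : IsRelationBasis (fun e => (P e).rep) w₁ w₂) (p : ι) (N m : ℕ)
    (fs : List (Module.Dual K (Fin (n + 1) → K))) (hfs : fs.length < m) (hN : m ≤ N + 1)
    (prs : List (ι × ι)) (hlen : prs.length = N + m - fs.length)
    (hprs : ∀ x ∈ prs, x.1 ≠ p ∧ x.2 ≠ p ∧ minor w₁ w₂ x.1 x.2 ≠ 0)
    (hcount : ∀ e, prs.countP (fun x => e = x.1 ∨ e = x.2) ≤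
      N - fs.countP (fun f => f (P e).rep ≠ 0)) :
    ∃ Ls : List (Module.Dual K (Fin (n + 1) → K)), Ls.length + fs.length = N + m ∧
      (∀ L ∈ Ls, L (P p).rep = 1) ∧ (fs.map (linForm K n)).prod * (Ls.map (linForm K n)).prod ∈
        ⨅ i : ι, ⨅ _ : i ≠ p, pointIdeal (P i) ^ m := by
  have hex : ∀ x : ι × ι, ∃ L : Module.Dual K (Fin (n + 1) → K), x ∈ prs →
      L (P p).rep = 1 ∧ ∀ e, e ≠ p → e ≠ x.1 → e ≠ x.2 → L (P e).rep = 0 := by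
    intro x
    by_cases hx : x ∈ prs
    · obtain ⟨h1, h2, h3⟩ := hprs x hx
      obtain ⟨L, hL⟩ := hw.exists_dual h3 h1.symm h2.symm
      exact ⟨L, fun _ => hL⟩
    · exact ⟨0, fun h => absurd h hx⟩
  choose L hL using hex
  refine ⟨prs.map L, by rw [List.length_map]; omega, ?_, ?_⟩
  · intro L' hL'
    obtain ⟨x, hx, rfl⟩ := List.mem_map.1 hL'
    exact (hL x hx).1
  simp only [Ideal.mem_iInf]
  intro e he
  have h1 := Ideal.mul_mem_mul (prod_mem_pointIdeal_pow (P e) fs)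
    (prod_mem_pointIdeal_pow (P e) (prs.map L))
  rw [← pow_add] at h1
  -- At most `fs.length < m ≤ N + 1` factors of `fs` are nonzero at `P e`, so the subtraction in
  -- `hcount` is exact and at least `m` factors vanish there.
  refine Ideal.pow_le_pow_right ?_ h1
  have h2 := List.length_eq_countP_add_countP (fun f => decide (f (P e).rep = 0)) (l := fs)
  have h3 := List.length_eq_countP_add_countP (fun f => decide (f (P e).rep = 0))
    (l := prs.map L)
  have h4 : (prs.map L).countP (fun f => ¬ decide (f (P e).rep = 0)) ≤
      prs.countP (fun x => e = x.1 ∨ e = x.2) := by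
    rw [List.countP_map]
    refine List.countP_mono_left fun x hx h => ?_
    simp only [Function.comp_apply, decide_eq_true_eq] at h ⊢
    by_contra! h0
    exact h ((hL x hx).2 e he h0.1 h0.2)
  have h5 := hcount e
  have h6 : fs.countP (fun f => decide (f (P e).rep ≠ 0)) =
      fs.countP (fun f => ¬ decide (f (P e).rep = 0)) := by
    congr 1
    ext f
    simp
  rw [List.length_map] at h3
  omega

end Completion

end FatPoints

/-! ### Proof of the theorem -/

open scoped LinearAlgebra.Projectivization in
theorem proposition4p3 {K : Type*} [Field K] [IsAlgClosed K] (n s m : ℕ)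
    (hs : 2 ≤ s) (hsn : s ≤ n) (hm : 1 ≤ m)
    (P : Fin (s + 3) → ℙ K (Fin (n + 1) → K)) (hP : Function.Injective P)
    (γ : Submodule K (Fin (n + 1) → K)) (hγ : Module.finrank K γ = s + 1)
    (hPγ : ∀ i, (P i).submodule ≤ γ)
    (hgen : ¬ FatPoints.InGeneralPositionOn P s γ)
    (hspan : ¬ FatPoints.LieOnLinearSpace P Finset.univ (s - 1)) :
    ∃ i₀ : Fin (s + 3), ∃ r : ℕ,
      FatPoints.IsRegularityIndex
        ((⨅ i : Fin (s + 3), ⨅ _ : i ≠ i₀, FatPoints.pointIdeal (P i) ^ m) ⊔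
          FatPoints.pointIdeal (P i₀) ^ m) r ∧
      r ≤ (Finset.Icc 1 n).sup (fun j => FatPoints.segreT P m j) := by
  classical
  open FatPoints in
  set v : Fin (s + 3) → (Fin (n + 1) → K) := fun e => (P e).rep with hv
  have hrank : Module.finrank K (Submodule.span K (Set.range v)) = s + 1 := by
    refine le_antisymm ?_ (not_lt.1 fun hlt => hspan ?_)
    · rw [← hγ]
      refine Submodule.finrank_mono (Submodule.span_le.2 ?_)
      rintro _ ⟨e, rfl⟩
      have := hPγ e
      rwa [Projectivization.submodule_eq, Submodule.span_singleton_le_iff_mem] at this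
    · obtain ⟨L, hL, hr⟩ := exists_le_finrank_eq (Submodule.span K (Set.range v)) s (by omega)
        (by rw [Module.finrank_fin_fun]; omega)
      refine ⟨L, by omega, fun i _ => ?_⟩
      rw [Projectivization.submodule_eq, Submodule.span_singleton_le_iff_mem]
      exact hL (Submodule.subset_span ⟨i, rfl⟩)
  obtain ⟨w₁, w₂, hw⟩ := exists_isRelationBasis v (by rw [hrank, Fintype.card_fin])
  set b := (Finset.Icc 1 n).sup (fun j => segreT P m j) with hb
  have bound : ∀ (S T : Finset (Fin (s + 3))) (j : ℕ), S.Nonempty → 1 ≤ j → j ≤ n →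
      T.card ≤ j + 1 → (∀ e ∈ S, v e ∈ Submodule.span K (v '' T)) → m * S.card ≤ b * j + 1 :=
    fun S T j hS hj hjn hT h => card_mul_le_sup_segreT P m S hS j hj hjn
      ((finrank_span_image_le_card v S T h).trans hT)
  have hv0 : ∀ e, v e ≠ 0 := fun e => (P e).rep_nonzero
  have hvne : ∀ e e', e ≠ e' → ∀ a : K, v e ≠ a • v e' := fun e e' h a =>
    rep_ne_smul_rep (fun h' => h (hP h')) a
  -- The line through two of the points gives `2m ≤ b + 1`.
  obtain ⟨N, hN⟩ : ∃ N, b = N + m ∧ m ≤ N + 1 := by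
    have := bound {0, 1} {0, 1} 1 (by simp) le_rfl (by omega) (by simp)
      (fun e he => Submodule.subset_span ⟨e, he, rfl⟩)
    have h2 : ({0, 1} : Finset (Fin (s + 3))).card = 2 := by
      rw [Finset.card_pair]
      exact Fin.zero_ne_one
    rw [h2] at this
    exact ⟨b - m, by omega, by omega⟩
  obtain ⟨hbN, hmN⟩ := hN
  set A : Finset (Fin (s + 3)) := Finset.univ.filter fun e => w₁ e ≠ 0 ∨ w₂ e ≠ 0 with hA
  have memA : ∀ {e}, e ∈ A ↔ (w₁ e ≠ 0 ∨ w₂ e ≠ 0) := by simp [hA]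
  have memA_of : ∀ {e f}, minor w₁ w₂ e f ≠ 0 → e ∈ A := fun h =>
    memA.2 (ne_zero_of_minor_ne_zero h)
  have hcls : ∀ {e f}, e ∈ A → f ∈ A →
      (ratio w₁ w₂ e = ratio w₁ w₂ f ↔ minor w₁ w₂ e f = 0) :=
    fun he hf => ratio_eq_iff w₁ w₂ (memA.1 he) (memA.1 hf)
  have memS : ∀ x ∈ A, ∀ e, e ∈ A.filter (fun e => ratio w₁ w₂ e ≠ ratio w₁ w₂ x) ↔
      minor w₁ w₂ e x ≠ 0 := by
    intro x hx e
    rw [Finset.mem_filter]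
    exact ⟨fun h h' => h.2 ((hcls h.1 hx).2 h'), fun h =>
      ⟨memA_of h, fun h' => h ((hcls (memA_of h) hx).1 h')⟩⟩
  have hq : ∀ x ∈ A, 3 ≤ (A.filter fun e => ratio w₁ w₂ e ≠ ratio w₁ w₂ x).card := by
    intro x hx
    obtain ⟨y, hy⟩ := hw.exists_minor_ne_zero (memA.1 hx)
    exact three_le_card_support v hv0 hvne (fun e => minor w₁ w₂ e x)
      (sum_minor_smul v hw.rel₁ hw.rel₂ x) _ (fun e he => (memS x hx e).2 he) y hy
  have hlt : ∀ x ∈ A, (A.filter fun e => ratio w₁ w₂ e ≠ ratio w₁ w₂ x).card < A.card :=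
    fun x hx => Finset.card_lt_card (Finset.filter_ssubset.2 ⟨x, hx, by simp⟩)
  have hAs : A.card ≤ s + 3 := (Finset.card_le_univ A).trans (by simp)
  have hqN : ∀ x ∈ A, 2 * m ≤
      ((A.filter fun e => ratio w₁ w₂ e ≠ ratio w₁ w₂ x).card - 2) * N + 1 := by
    intro x hx
    have h3 := hq x hx
    have h4 := hlt x hx
    obtain ⟨y, hy⟩ := hw.exists_minor_ne_zero (memA.1 hx)
    set S := A.filter fun e => ratio w₁ w₂ e ≠ ratio w₁ w₂ x with hS
    have hyS : y ∈ S := (memS x hx y).2 hy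
    obtain ⟨q, hqS⟩ : ∃ q, S.card = q + 2 := ⟨S.card - 2, by omega⟩
    have hT : (S.erase y).card = q + 1 := by rw [Finset.card_erase_of_mem hyS]; omega
    have := bound S (S.erase y) q ⟨y, hyS⟩ (by omega) (by omega) hT.le (fun e he => by
      by_cases hey : e = y
      · rw [hey]
        exact mem_span_of_relation v (fun e => minor w₁ w₂ e x)
          (sum_minor_smul v hw.rel₁ hw.rel₂ x) _ y hy (fun e he => by
            by_cases h : e = y
            · exact Or.inl h
            · exact Or.inr (Finset.mem_erase.2 ⟨h, (memS x hx e).2 he⟩))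
      · exact Submodule.subset_span ⟨e, Finset.mem_erase.2 ⟨hey, he⟩, rfl⟩)
    rw [hqS] at this ⊢
    rw [hbN] at this
    rw [Nat.add_sub_cancel]
    nlinarith
  obtain ⟨y₀, z₀, hyz₀⟩ := hw.exists_minor
  have hy₀ : y₀ ∈ A := memA_of hyz₀
  have hzy₀ : minor w₁ w₂ z₀ y₀ ≠ 0 := by rw [minor_swap]; exact neg_ne_zero.2 hyz₀
  have hz₀ : z₀ ∈ A := memA_of hzy₀
  have hA4 : 4 ≤ A.card := (hq y₀ hy₀).trans_lt (hlt y₀ hy₀)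
  have hAN : 3 * m ≤ (A.card - 3) * N + 1 := by
    obtain ⟨q, hqA⟩ : ∃ q, A.card = q + 3 := ⟨A.card - 3, by omega⟩
    have hne : z₀ ≠ y₀ := fun h => hyz₀ (by rw [h, minor_self])
    have hT : ((A.erase y₀).erase z₀).card = q + 1 := by
      rw [Finset.card_erase_of_mem (Finset.mem_erase.2 ⟨hne, hz₀⟩),
        Finset.card_erase_of_mem hy₀]
      omega
    have key : ∀ y z, y ∈ A → minor w₁ w₂ y z ≠ 0 → ∀ T : Finset (Fin (s + 3)),
        (∀ e ∈ A, e = y ∨ e = z ∨ e ∈ T) → v y ∈ Submodule.span K (v '' T) := by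
      intro y z _ h T hT
      refine mem_span_of_relation v (fun e => minor w₁ w₂ e z)
        (sum_minor_smul v hw.rel₁ hw.rel₂ z) T y h fun e he => ?_
      rcases hT e (memA_of he) with h1 | h1 | h1
      · exact Or.inl h1
      · exact absurd (by rw [h1, minor_self]) he
      · exact Or.inr h1
    have hmem : ∀ e ∈ A, e = y₀ ∨ e = z₀ ∨ e ∈ (A.erase y₀).erase z₀ := fun e he => by
      simp only [Finset.mem_erase]; tauto
    have := bound A ((A.erase y₀).erase z₀) q ⟨y₀, hy₀⟩ (by omega) (by omega) hT.le
      (fun e he => by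
        rcases hmem e he with h | h | h
        · rw [h]; exact key y₀ z₀ hy₀ hyz₀ _ hmem
        · rw [h]; exact key z₀ y₀ hz₀ hzy₀ _ fun e he => or_left_comm.1 (hmem e he)
        · exact Submodule.subset_span ⟨e, h, rfl⟩)
    rw [hqA] at this ⊢
    rw [hbN] at this
    rw [Nat.add_sub_cancel]
    nlinarith
  -- If `A` is everything, take `p` among `j + 2` points on a `j`-space with `j < s`: the at least
  -- two points off this set share a class.
  obtain ⟨p, hp⟩ : ∃ p, p ∈ A → ∃ x ∈ A, x ≠ p ∧
      2 ≤ (A.filter fun e => e ≠ p ∧ ratio w₁ w₂ e = ratio w₁ w₂ x).card := by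
    by_cases hall : ∃ p, p ∉ A
    · exact ⟨hall.choose, fun h => absurd h hall.choose_spec⟩
    push Not at hall
    have : ∃ j < s, ∃ S : Finset (Fin (s + 3)), S.card = j + 2 ∧ LieOnLinearSpace P S j := by
      by_contra! h
      exact hgen ⟨hγ, hPγ, h⟩
    obtain ⟨j, hj, S, hS, L, hL, hSL⟩ := this
    obtain ⟨p, hpS⟩ : S.Nonempty := Finset.card_pos.1 (by omega)
    have hSc : 1 < Sᶜ.card := by rw [Finset.card_compl, Fintype.card_fin]; omega
    obtain ⟨x, hx, x', hx', hne⟩ := Finset.one_lt_card.1 hSc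
    rw [Finset.mem_compl] at hx hx'
    have hmin := hw.minor_eq_zero_of_notMem L S (fun e he => by
      have := hSL e he
      rwa [Projectivization.submodule_eq, Submodule.span_singleton_le_iff_mem] at this)
      (by omega) hx' hx
    refine ⟨p, fun _ => ⟨x, hall x, fun h => hx (h ▸ hpS), ?_⟩⟩
    refine Finset.one_lt_card.2 ⟨x, ?_, x', ?_, hne⟩
    · exact Finset.mem_filter.2 ⟨hall x, fun h => hx (h ▸ hpS), rfl⟩
    · exact Finset.mem_filter.2 ⟨hall x', fun h => hx' (h ▸ hpS),
        (hcls (hall x') (hall x)).2 hmin⟩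
  obtain ⟨y, hyA, z, hzA, hyp, hzp, hyz, hymax, hzmax⟩ :=
    exists_max_class_pair A (ratio w₁ w₂) p hq (by omega)
  have hmyz : minor w₁ w₂ y z ≠ 0 := fun h => hyz ((hcls hyA hzA).2 h)
  have span_of : ∀ f : Module.Dual K (Fin (n + 1) → K), f (v p) = 0 →
      f ∈ Submodule.span K (sparseForms v w₁ w₂ p y z) :=
    hw.mem_span_sparseForms hmyz hyp hzp
  refine ⟨p, exists_isRegularityIndex_le _ b fun u hu f hf =>
    homogeneous_mem_of_prod_linForm_mem _ b (fun gs hgs => ?_) hu hf⟩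
  refine prod_mem_of_exists_completion (linForm K n) _ (sparseForms v w₁ w₂ p y z) b m
    (fun fs hfs hlen => Ideal.mem_sup_right ?_) (fun fs hfs hlen => ?_) gs hgs
  · have h1 := prod_mem_pointIdeal_pow (P p) fs
    rwa [List.countP_eq_length.2 fun f hf => decide_eq_true (hfs f hf).1, hlen] at h1
  obtain ⟨htot, hout⟩ := weight_bounds A (ratio w₁ w₂) p y z N m hyA hzA hyp hzp hyz hymax hzmax
    hq hqN hA4 hAN hmN hp (fun f : Module.Dual K (Fin (n + 1) → K) =>
      Finset.univ.filter fun e => f (v e) ≠ 0) fs hlen (fun f hf => by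
      obtain ⟨-, k, hkp, hk⟩ := hfs f hf
      refine ⟨k, hkp, fun e he => ?_⟩
      rcases hk e (Finset.mem_filter.1 he).2 with h | h | h
      · exact Or.inl h
      · exact Or.inr (Or.inl ⟨h.1, memA_of h.2, fun h' => h.2 ((hcls (memA_of h.2) hzA).1 h')⟩)
      · exact Or.inr (Or.inr ⟨h.1, memA_of h.2, fun h' => h.2 ((hcls (memA_of h.2) hyA).1 h')⟩))
  obtain ⟨prs, hlen', hprs, hcount⟩ := exists_pairing (A.erase p) (ratio w₁ w₂) _ _ htot hout
  obtain ⟨Ls, hLs, hL1, hmem⟩ := exists_completion P hw p N m fs hlen hmN prs hlen'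
    (fun x hx => by
      obtain ⟨h1, h2, h3⟩ := hprs x hx
      rw [Finset.mem_erase] at h1 h2
      exact ⟨h1.1, h2.1, fun h => h3 ((hcls h1.2 h2.2).2 h)⟩)
    (fun e => by simpa using hcount e)
  refine ⟨Ls, by omega, fun L hL g => ⟨g (v p), span_of _ ?_⟩, Ideal.mem_sup_left hmem⟩
  have := hL1 L hL
  simp only [LinearMap.sub_apply, LinearMap.smul_apply, smul_eq_mul, hv, this, mul_one, sub_self]
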